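/- A partial Steiner triple system of order \(u\) is a pair \((U,\mathcal A)\) where \(U\) is a set with \(u\) elements and \(\mathcal A\) is a set of 3-element subsets of \(U\) (triples) such that every pair of distinct elements of \(U\) is contained in at most one triple; it is a Steiner triple system if every such pair is contained in exactly one triple. An embedding of order \(v\) of \((U,\mathcal A)\) is a Steiner triple system \((V,\mathcal B)\) of order \(v\) with \(U\subseteq V\) and \(\mathcal A\subseteq\mathcal B\). (i) Let \(u\ge 2\) and \(t\ge 1\) be integers with \(\frac{u+1}{2}\le t<\frac16(u^2-5u+16)\). Then there is a partial Steiner triple system of order \(u\) with at most \(t\) triples that has no embedding of order \(v\) for any integer \(v\le u+\sqrt{6t-3u}-1\). (ii) Consequently, for every sufficiently large integer \(u\) there is a partial Steiner triple system of order \(u\) with at most \(\frac{u^2}{50}-\frac{11u}{100}-\frac{116}{75}\) triples that has no embedding of order \(v\) for any integer \(v<1.346\,u\). -/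

import Mathlib

/-- A partial Steiner triple system `(U, 𝒜)` whose points are taken from an ambient type `α`:
a finite set `U` and a set `𝒜` of `3`-element subsets of `U` such that every pair of distinct
elements of `U` is a subset of at most one triple. -/
structure PartialSTS (α : Type*) where
  /-- the point set `U` -/
  points : Finset α
  /-- the set `𝒜` of triples -/
  triples : Finset (Finset α)
  triples_subset : ∀ s ∈ triples, s ⊆ points
  card_triple : ∀ s ∈ triples, s.card = 3
  pair_unique : ∀ x ∈ points, ∀ y ∈ points, x ≠ y →
    ∀ s ∈ triples, ∀ t ∈ triples, x ∈ s → y ∈ s → x ∈ t → y ∈ t → s = t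

namespace PartialSTS

variable {α : Type*}

/-- The order of a partial Steiner triple system is its number of points. -/
def order (S : PartialSTS α) : ℕ := S.points.card

/-- A (complete) Steiner triple system: every pair of distinct points is a subset of exactly
one triple. -/
def IsSteiner (S : PartialSTS α) : Prop :=
  ∀ x ∈ S.points, ∀ y ∈ S.points, x ≠ y → ∃! s, s ∈ S.triples ∧ x ∈ s ∧ y ∈ s

/-- `T = (V, ℬ)` is an embedding of `S = (U, 𝒜)`: it is a Steiner triple system with
`U ⊆ V` and `𝒜 ⊆ ℬ`. -/
def IsEmbedding (S T : PartialSTS α) : Prop :=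
  T.IsSteiner ∧ S.points ⊆ T.points ∧ S.triples ⊆ T.triples

/-- `S` has an embedding of order `v`. The new points come from the ambient type; this is no
restriction when that type is infinite, since the names of the finitely many new points
do not matter. -/
def HasEmbedding (S : PartialSTS α) (v : ℕ) : Prop :=
  ∃ T : PartialSTS α, S.IsEmbedding T ∧ T.order = v

end PartialSTS

open Finset

/-! The obstruction is local. Choose a set `Z` of `z` points all of whose pairs are already covered,
and a further point `x` joined by triples to every point outside `Z` and to none inside. In an
embedding, the triple through `x` and a point of `Z` must have a new third point, and different
points of `Z` need different new points; hence `v ≥ u + z` (`order_add_card_le_of_hasEmbedding`).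

The cost is a core covering `Z`, with at most `(z² + z + 9) / 6` triples, plus `a = (u - z - 1) / 2`
triples through `x`. Six times the total is at most `(z - 1)² + 3u + 5`, so `z` can be taken as
`⌊√(6t - 3u)⌋` or one more, whichever has the parity of `u - 1`.

Cores exist for every `z ≥ 2` (`exists_core`): Bose and Skolem systems for `z ≡ 3, 1` mod 6, these
less a point for `z ≡ 2, 0`, and a twisted Bose system with one block of size 5 for `z ≡ 5, 4`. A
few auxiliary points `Y` are allowed outside `Z`. Linearity of the constructed systems follows from
covering and counting (`isLinear_of_covers`). -/

/-- Distinct members of the family `B` meet in at most one point. -/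
def IsLinear {α : Type*} [DecidableEq α] (B : Finset (Finset α)) : Prop :=
  ∀ s ∈ B, ∀ t ∈ B, s ≠ t → #(s ∩ t) ≤ 1

/-- Every pair of distinct points of `P` lies in a member of the family `B`. -/
def Covers {α : Type*} (B : Finset (Finset α)) (P : Finset α) : Prop :=
  ∀ a ∈ P, ∀ b ∈ P, a ≠ b → ∃ s ∈ B, a ∈ s ∧ b ∈ s

/-- A linear family of triples on `Z ∪ Y` that covers all pairs of points of `Z` and no pair of
points of `Y`. -/
structure IsCore {α : Type*} [DecidableEq α] (Z Y : Finset α) (C : Finset (Finset α)) : Prop where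
  disj : Disjoint Z Y
  card_eq : ∀ s ∈ C, #s = 3
  subset : ∀ s ∈ C, s ⊆ Z ∪ Y
  card_inter : ∀ s ∈ C, #(s ∩ Y) ≤ 1
  linear : IsLinear C
  covers : Covers C Z

/-! ### Linear families, cores and pairings -/

section
theorem Covers.mono {α : Type*} {P P' : Finset α} {B : Finset (Finset α)} (h : Covers B P)
    (hP : P' ⊆ P) : Covers B P' := fun a ha b hb => h a (hP ha) b (hP hb)

variable {α β : Type*} [DecidableEq α] [DecidableEq β]

/-- A family of blocks that covers all pairs and is small enough is linear. -/
theorem isLinear_of_covers {P : Finset α} {B : Finset (Finset α)} (hsub : ∀ b ∈ B, b ⊆ P)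
    (hcov : Covers B P) (hcount : ∑ b ∈ B, #b.offDiag ≤ #P.offDiag) : IsLinear B := by
  intro s hs t ht hst
  by_contra! hcard
  obtain ⟨a, ha, b, hb, hab⟩ := Finset.one_lt_card.mp hcard
  rw [Finset.mem_inter] at ha hb
  have hdc : ∑ p ∈ P.offDiag, #{b ∈ B | p.1 ∈ b ∧ p.2 ∈ b} = ∑ b ∈ B, #b.offDiag := by
    have := Finset.sum_card_bipartiteAbove_eq_sum_card_bipartiteBelow
      (fun (p : α × α) (b : Finset α) => p.1 ∈ b ∧ p.2 ∈ b) (s := P.offDiag) (t := B)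
    refine this.trans (Finset.sum_congr rfl fun b hb => ?_)
    congr 1
    ext p
    simp only [Finset.bipartiteBelow, Finset.mem_filter, Finset.mem_offDiag]
    have := hsub b hb
    grind
  -- Covering makes every summand at least 1, and `(a, b)` lies in both `s` and `t`, so it
  -- contributes at least 2.
  have hlt : ∑ p ∈ P.offDiag, 1 < ∑ p ∈ P.offDiag, #{b ∈ B | p.1 ∈ b ∧ p.2 ∈ b} := by
    refine Finset.sum_lt_sum (fun p hp => ?_) ⟨(a, b), ?_, ?_⟩
    · rw [Finset.mem_offDiag] at hp
      obtain ⟨c, hc, h1, h2⟩ := hcov _ hp.1 _ hp.2.1 hp.2.2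
      exact Finset.card_pos.mpr ⟨c, by simp [hc, h1, h2]⟩
    · exact Finset.mem_offDiag.mpr ⟨hsub s hs ha.1, hsub s hs hb.1, hab⟩
    · exact Finset.one_lt_card.mpr ⟨s, by simp [*], t, by simp [*], hst⟩
  rw [Finset.sum_const, smul_eq_mul, mul_one] at hlt
  omega

/-- Replacing a block `b` of a linear family on `P` by a linear family whose members meet `P`
inside `b` yields a linear family. -/
theorem IsLinear.replace {P b : Finset α} {B D : Finset (Finset α)} (hsub : ∀ s ∈ B, s ⊆ P)
    (hB : IsLinear (insert b B)) (hb : b ∉ B) (hD : IsLinear D) (hDb : ∀ d ∈ D, d ∩ P ⊆ b) :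
    IsLinear (B ∪ D) := by
  have key : ∀ s ∈ B, ∀ d ∈ D, #(s ∩ d) ≤ 1 := fun s hs d hd => by
    refine le_trans (Finset.card_le_card fun p hp => ?_)
      (hB s (mem_insert_of_mem hs) b (mem_insert_self _ _) fun h => hb (h ▸ hs))
    rw [mem_inter] at hp ⊢
    exact ⟨hp.1, hDb d hd (mem_inter.mpr ⟨hp.2, hsub s hs hp.1⟩)⟩
  intro s hs t ht hst
  rcases mem_union.mp hs with hs | hs <;> rcases mem_union.mp ht with ht | ht
  · exact hB s (mem_insert_of_mem hs) t (mem_insert_of_mem ht) hst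
  · exact key s hs t ht
  · rw [inter_comm]; exact key t ht s hs
  · exact hD s hs t ht hst

/-- Linearity can be checked on the image of a family under an embedding. -/
theorem IsLinear.map {B : Finset (Finset β)} (h : IsLinear B) (f : β ↪ α) :
    IsLinear (B.image (Finset.map f)) := by
  intro s' hs' t' ht' hst
  obtain ⟨s, hs, rfl⟩ := mem_image.mp hs'
  obtain ⟨t, ht, rfl⟩ := mem_image.mp ht'
  rw [← Finset.map_inter, Finset.card_map]
  exact h s hs t ht fun e => hst (e ▸ rfl)

theorem IsCore.map {Z Y : Finset β} {C : Finset (Finset β)} (h : IsCore Z Y C) (f : β ↪ α) :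
    IsCore (Z.map f) (Y.map f) (C.image (Finset.map f)) where
  disj := (Finset.disjoint_map f).mpr h.disj
  card_eq s' hs' := by
    obtain ⟨s, hs, rfl⟩ := mem_image.mp hs'
    rw [Finset.card_map, h.card_eq s hs]
  subset s' hs' := by
    obtain ⟨s, hs, rfl⟩ := mem_image.mp hs'
    rw [← Finset.map_union]
    exact Finset.map_subset_map.mpr (h.subset s hs)
  card_inter s' hs' := by
    obtain ⟨s, hs, rfl⟩ := mem_image.mp hs'
    rw [← Finset.map_inter, Finset.card_map]
    exact h.card_inter s hs
  linear := h.linear.map f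
  covers a' ha' b' hb' hab := by
    obtain ⟨a, ha, rfl⟩ := mem_map.mp ha'
    obtain ⟨b, hb, rfl⟩ := mem_map.mp hb'
    obtain ⟨s, hs, h1, h2⟩ := h.covers a ha b hb fun e => hab (e ▸ rfl)
    exact ⟨_, mem_image_of_mem _ hs, mem_map_of_mem _ h1, mem_map_of_mem _ h2⟩

/-- A Steiner triple system is a core. -/
theorem isCore_of_covers {P : Finset α} {C : Finset (Finset α)} (hcard : ∀ s ∈ C, #s = 3)
    (hsub : ∀ s ∈ C, s ⊆ P) (hcov : Covers C P) (hcount : 6 * #C ≤ #P.offDiag) :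
    IsCore P ∅ C where
  disj := disjoint_empty_right _
  card_eq := hcard
  subset := by simpa using hsub
  card_inter := by simp
  linear := isLinear_of_covers hsub hcov <| by
    rw [Finset.sum_congr rfl fun s hs => by rw [offDiag_card, hcard s hs], Finset.sum_const,
      smul_eq_mul]
    omega
  covers := hcov

/-- No triple is discarded: the removed point becomes the sole member of `Y`, so a Steiner system
also yields a core with one point fewer in `Z`. -/
theorem IsCore.erase {P : Finset α} {C : Finset (Finset α)} (h : IsCore P ∅ C) (p : α) :
    IsCore (P.erase p) {p} C where
  disj := by simp
  card_eq := h.card_eq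
  subset s hs a ha := by
    have := h.subset s hs ha
    simp only [union_empty] at this
    simp only [mem_union, mem_erase, mem_singleton]
    tauto
  card_inter s _ := (card_le_card inter_subset_right).trans (card_singleton p).le
  linear := h.linear
  covers := h.covers.mono (erase_subset _ _)

/-- A set of even size can be partitioned into pairs. -/
theorem exists_pairing (a : ℕ) : ∀ Y : Finset α, #Y = 2 * a → ∃ M : Finset (Finset α),
    #M ≤ a ∧ (∀ s ∈ M, #s = 2 ∧ s ⊆ Y) ∧ (∀ y ∈ Y, ∃ s ∈ M, y ∈ s) ∧
    ∀ s ∈ M, ∀ t ∈ M, s ≠ t → Disjoint s t := by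
  induction a with
  | zero => exact fun Y hY => ⟨∅, by simp_all⟩
  | succ a ih =>
    intro Y hY
    obtain ⟨s, hs, hs2⟩ := Finset.exists_subset_card_eq (show 2 ≤ #Y by omega)
    obtain ⟨M, hM, h1, h2, h3⟩ := ih (Y \ s) (by rw [card_sdiff_of_subset hs]; omega)
    have hd : ∀ t ∈ M, Disjoint s t := fun t ht =>
      disjoint_of_subset_right (h1 t ht).2 disjoint_sdiff
    refine ⟨insert s M, (card_insert_le _ _).trans (by omega), ?_, ?_, ?_⟩
    · intro t ht
      rcases mem_insert.mp ht with rfl | ht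
      · exact ⟨hs2, hs⟩
      · exact ⟨(h1 t ht).1, (h1 t ht).2.trans sdiff_subset⟩
    · intro y hy
      by_cases hys : y ∈ s
      · exact ⟨s, mem_insert_self _ _, hys⟩
      · obtain ⟨t, ht, hyt⟩ := h2 y (mem_sdiff.mpr ⟨hy, hys⟩)
        exact ⟨t, mem_insert_of_mem ht, hyt⟩
    · intro t ht t' ht' hne
      rcases mem_insert.mp ht with e | htM <;> rcases mem_insert.mp ht' with e' | htM'
      · exact absurd (e.trans e'.symm) hne
      · exact e ▸ hd t' htM'
      · exact e' ▸ (hd t htM).symm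
      · exact h3 t htM t' htM' hne
end

/-! ### The lower bound on the order of an embedding -/

namespace PartialSTS

/-- If all pairs in `Z` are covered, `x` lies in no triple meeting `Z`, and `x` is joined to all
remaining points, then an embedding needs at least `#Z` new points. -/
theorem order_add_card_le_of_hasEmbedding {α : Type*} {S : PartialSTS α} {x : α} {Z : Finset α}
    (hx : x ∈ S.points) (hZ : Z ⊆ S.points) (hxZ : x ∉ Z) (hcov : Covers S.triples Z)
    (hmiss : ∀ s ∈ S.triples, x ∈ s → ∀ z ∈ Z, z ∉ s)
    (hjoin : ∀ y ∈ S.points, y ≠ x → y ∉ Z → ∃ s ∈ S.triples, x ∈ s ∧ y ∈ s)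
    {v : ℕ} (h : S.HasEmbedding v) : S.order + #Z ≤ v := by
  classical
  obtain ⟨T, ⟨hT, hpts, htri⟩, rfl⟩ := h
  have key : ∀ z ∈ Z, ∃ w ∈ T.points \ S.points, ∃ s ∈ T.triples, x ∈ s ∧ z ∈ s ∧ w ∈ s := by
    intro z hz
    have hzx : x ≠ z := fun e => hxZ (e ▸ hz)
    obtain ⟨s, ⟨hs, hxs, hzs⟩, -⟩ := hT x (hpts hx) z (hpts (hZ hz)) hzx
    obtain ⟨w, hws, hwx, hwz⟩ : ∃ w ∈ s, w ≠ x ∧ w ≠ z := by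
      have : ((s.erase x).erase z).Nonempty := by
        rw [← card_pos, card_erase_of_mem (mem_erase.mpr ⟨hzx.symm, hzs⟩), card_erase_of_mem hxs,
          T.card_triple s hs]
        norm_num
      obtain ⟨w, hw⟩ := this
      exact ⟨w, by simp_all⟩
    have hwT := T.triples_subset s hs hws
    refine ⟨w, mem_sdiff.mpr ⟨hwT, fun hwS => ?_⟩, s, hs, hxs, hzs, hws⟩
    -- An old third point `w` would force `s` to be an original triple, through `w` and `z` or
    -- through `w` and `x`; but no original triple contains both `x` and a point of `Z`.
    by_cases hwZ : w ∈ Z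
    · obtain ⟨s', hs', h1, h2⟩ := hcov w hwZ z hz hwz
      have := T.pair_unique w hwT z (hpts (hZ hz)) hwz s hs s' (htri hs') hws hzs h1 h2
      exact hmiss s' hs' (this ▸ hxs) z hz h2
    · obtain ⟨s', hs', h1, h2⟩ := hjoin w hwS hwx hwZ
      have := T.pair_unique w hwT x (hpts hx) hwx s hs s' (htri hs') hws hxs h2 h1
      exact hmiss s' hs' h1 z hz (this ▸ hzs)
  choose! f hf g hg hxg hzg hfg using key
  -- A new point shared by `z` and `z'` would put `x`, `z`, `z'` and that point into a single
  -- triple.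
  have hinj : Set.InjOn f Z := by
    intro z hz z' hz' e
    by_contra hne
    have hfx : x ≠ f z := fun e => (mem_sdiff.mp (hf z hz)).2 (e ▸ hx)
    have hgg := T.pair_unique x (hpts hx) (f z) (mem_sdiff.mp (hf z hz)).1 hfx (g z) (hg z hz)
      (g z') (hg z' hz') (hxg z hz) (hfg z hz) (hxg z' hz') (e ▸ hfg z' hz')
    have hsub : ({x, z, z', f z} : Finset α) ⊆ g z := by
      intro a ha
      simp only [mem_insert, mem_singleton] at ha
      rcases ha with rfl | rfl | rfl | rfl
      · exact hxg z hz
      · exact hzg _ hz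
      · exact hgg ▸ hzg _ hz'
      · exact hfg z hz
    have h4 : #({x, z, z', f z} : Finset α) = 4 := by
      have h1 : x ≠ z := fun e => hxZ (e ▸ hz)
      have h2 : x ≠ z' := fun e => hxZ (e ▸ hz')
      have h3 : z ≠ f z := fun e => (mem_sdiff.mp (hf z hz)).2 (e ▸ hZ hz)
      have h5 : z' ≠ f z := fun e => (mem_sdiff.mp (hf z hz)).2 (e ▸ hZ hz')
      rw [card_insert_of_notMem, card_insert_of_notMem, card_insert_of_notMem, card_singleton] <;>
        simp [h1, h2, h3, h5, hfx, hne]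
    have := card_le_card hsub
    rw [h4, T.card_triple _ (hg z hz)] at this
    omega
  have h1 : #Z ≤ #(T.points \ S.points) := card_le_card_of_injOn f (fun z hz => hf z hz) hinj
  have h2 := card_sdiff_add_card_eq_card hpts
  unfold order
  omega

/-- A core on `Z ∪ Y` extends, for every admissible number `a` of pairs of points outside `Z`, to a
partial triple system all of whose embeddings have at least `#Z` new points. -/
theorem exists_of_isCore {α : Type*} [Infinite α] [DecidableEq α] {Z Y : Finset α}
    {C : Finset (Finset α)} (h : IsCore Z Y C) {a : ℕ} (ha : #Y ≤ 2 * a) :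
    ∃ S : PartialSTS α, S.order = #Z + 2 * a + 1 ∧ #S.triples ≤ #C + a ∧
      ∀ v, S.HasEmbedding v → S.order + #Z ≤ v := by
  -- Fresh points pad `Y` to even size `2a`, so that `x` can be joined to all of `Y'` by triples.
  obtain ⟨Y', hYsub, hYcard⟩ : ∃ Y' : Finset α, Y ⊆ Y' ∧ #Y' = 2 * a ∧ Disjoint Z Y' := by
    obtain ⟨W, hW, hWc⟩ := Infinite.exists_superset_card_eq (Z ∪ Y) (#Z + 2 * a)
      (by rw [card_union_of_disjoint h.disj]; omega)
    refine ⟨W \ Z, fun y hy => mem_sdiff.mpr ⟨hW (mem_union_right _ hy), fun hz =>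
      disjoint_left.mp h.disj hz hy⟩, ?_, disjoint_sdiff⟩
    rw [card_sdiff_of_subset (subset_union_left.trans hW)]
    omega
  obtain ⟨hY2, hZY⟩ := hYcard
  obtain ⟨x, hx⟩ := Infinite.exists_notMem_finset (Z ∪ Y')
  obtain ⟨hxZ, hxY⟩ := not_or.mp (mt mem_union.mpr hx)
  obtain ⟨M, hMc, hM, hMcov, hMdisj⟩ := exists_pairing a Y' hY2
  have hCx : ∀ s ∈ C, x ∉ s := fun s hs hxs => by
    have := h.subset s hs hxs
    rcases mem_union.mp this with h | h
    · exact hxZ h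
    · exact hxY (hYsub h)
  -- A triple through `x` meets a core triple only inside `Y`; this is why a core must cover no pair
  -- of `Y`.
  have hCM : ∀ s ∈ C, ∀ m ∈ M, #(s ∩ insert x m) ≤ 1 := fun s hs m hm => by
    refine (card_le_card fun p hp => ?_).trans (h.card_inter s hs)
    obtain ⟨h1, h2⟩ := mem_inter.mp hp
    rcases mem_insert.mp h2 with rfl | h2
    · exact absurd h1 (hCx s hs)
    · refine mem_inter.mpr ⟨h1, (mem_union.mp (h.subset s hs h1)).resolve_left fun hz => ?_⟩
      exact disjoint_left.mp hZY hz ((hM m hm).2 h2)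
  have hlin : IsLinear (C ∪ M.image (insert x)) := by
    intro s hs t ht hst
    rcases mem_union.mp hs with hs | hs <;> rcases mem_union.mp ht with ht | ht
    · exact h.linear s hs t ht hst
    · obtain ⟨m, hm, rfl⟩ := mem_image.mp ht
      exact hCM s hs m hm
    · obtain ⟨m, hm, rfl⟩ := mem_image.mp hs
      rw [inter_comm]
      exact hCM t ht m hm
    · obtain ⟨m, hm, rfl⟩ := mem_image.mp hs
      obtain ⟨n, hn, rfl⟩ := mem_image.mp ht
      have hmn := hMdisj m hm n hn fun e => hst (e ▸ rfl)
      rw [← insert_inter_distrib, disjoint_iff_inter_eq_empty.mp hmn]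
      simp
  have hsub : ∀ s ∈ C ∪ M.image (insert x), s ⊆ insert x (Z ∪ Y') := by
    intro s hs
    rcases mem_union.mp hs with hs | hs
    · exact (h.subset s hs).trans ((union_subset_union_right hYsub).trans (subset_insert _ _))
    · obtain ⟨m, hm, rfl⟩ := mem_image.mp hs
      exact insert_subset_insert _ ((hM m hm).2.trans subset_union_right)
  let S : PartialSTS α :=
    { points := insert x (Z ∪ Y')
      triples := C ∪ M.image (insert x)
      triples_subset := hsub
      card_triple := fun s hs => by
        rcases mem_union.mp hs with hs | hs
        · exact h.card_eq s hs
        · obtain ⟨m, hm, rfl⟩ := mem_image.mp hs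
          rw [card_insert_of_notMem fun hxm => hxY ((hM m hm).2 hxm), (hM m hm).1]
      pair_unique := fun p _ q _ hpq s hs t ht hps hqs hpt hqt => by
        by_contra hst
        have := hlin s hs t ht hst
        have h2 := one_lt_card.mpr ⟨p, mem_inter.mpr ⟨hps, hpt⟩, q, mem_inter.mpr ⟨hqs, hqt⟩, hpq⟩
        omega }
  refine ⟨S, ?_, ?_, fun v hv => ?_⟩
  · change #(insert x (Z ∪ Y')) = _
    rw [card_insert_of_notMem hx, card_union_of_disjoint hZY, hY2]
  · exact (card_union_le _ _).trans (Nat.add_le_add_left (card_image_le.trans hMc) _)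
  · refine order_add_card_le_of_hasEmbedding (x := x) (mem_insert_self _ _)
      (subset_union_left.trans (subset_insert _ _)) hxZ ?_ ?_ ?_ hv
    · intro p hp q hq hpq
      obtain ⟨s, hs, h1⟩ := h.covers p hp q hq hpq
      exact ⟨s, mem_union_left _ hs, h1⟩
    · intro s hs hxs z hz hzs
      rcases mem_union.mp hs with hs | hs
      · exact hCx s hs hxs
      · obtain ⟨m, hm, rfl⟩ := mem_image.mp hs
        rcases mem_insert.mp hzs with rfl | hzm
        · exact hxZ hz
        · exact disjoint_left.mp hZY hz ((hM m hm).2 hzm)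
    · intro y hy hyx hyZ
      have hyY : y ∈ Y' := by
        rcases mem_insert.mp hy with h | h
        · exact absurd h hyx
        · exact (mem_union.mp h).resolve_left hyZ
      obtain ⟨m, hm, hym⟩ := hMcov y hyY
      exact ⟨insert x m, mem_union_right _ (mem_image_of_mem _ hm), mem_insert_self _ _,
        mem_insert_of_mem hym⟩

end PartialSTS

/-! ### Level blocks, common to the Bose-type constructions -/

section
variable {Q : Type*} [DecidableEq Q]

/-- The points of level `i` over `s`, together with the point of level `i + 1` over `f (∑ s)`. -/
def levelBlock [AddCommGroup Q] (f : Q → Q) (i : ZMod 3) (s : Finset Q) :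
    Finset ((Q × ZMod 3) ⊕ Fin 4) :=
  insert (.inl (f (∑ a ∈ s, a), i + 1)) (s.image fun a => .inl (a, i))

/-- All blocks `levelBlock (φ i) i s` over pairs `s`. -/
def levelBlocks [AddCommGroup Q] [Fintype Q] (φ : ZMod 3 → Q → Q) :
    Finset (Finset ((Q × ZMod 3) ⊕ Fin 4)) :=
  (univ ×ˢ powersetCard 2 univ).image fun p => levelBlock (φ p.1) p.1 p.2

theorem ZMod.three_ne_add_one (i : ZMod 3) : i ≠ i + 1 := by decide +revert

theorem inl_mem_fiber (c : Q) (i : ZMod 3) :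
    .inl (c, i) ∈ ({.inl (c, 0), .inl (c, 1), .inl (c, 2)} : Finset ((Q × ZMod 3) ⊕ Fin 4)) := by
  have h : ∀ i : ZMod 3, i = 0 ∨ i = 1 ∨ i = 2 := by decide
  rcases h i with rfl | rfl | rfl <;> simp

theorem card_levelBlock [AddCommGroup Q] (f : Q → Q) (i : ZMod 3) {s : Finset Q} (hs : #s = 2) :
    #(levelBlock f i s) = 3 := by
  rw [levelBlock, card_insert_of_notMem, card_image_of_injective, hs]
  · intro a b h
    simpa using h
  · simp [ZMod.three_ne_add_one i]

variable [AddCommGroup Q] [Fintype Q]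

theorem card_of_mem_levelBlocks {φ : ZMod 3 → Q → Q} {b} (hb : b ∈ levelBlocks φ) : #b = 3 := by
  obtain ⟨p, hp, rfl⟩ := mem_image.mp hb
  exact card_levelBlock _ _ (mem_powersetCard.mp (mem_product.mp hp).2).2

theorem card_levelBlocks_le (φ : ZMod 3 → Q → Q) :
    #(levelBlocks φ) ≤ 3 * (Fintype.card Q).choose 2 :=
  card_image_le.trans (by simp [ZMod.card])

theorem levelBlocks_subset {φ : ZMod 3 → Q → Q} (I : Finset (Fin 4)) {b}
    (hb : b ∈ levelBlocks φ) : b ⊆ univ.disjSum I := by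
  obtain ⟨p, -, rfl⟩ := mem_image.mp hb
  intro x hx
  simp only [levelBlock, mem_insert, mem_image] at hx
  rcases hx with rfl | ⟨a, -, rfl⟩ <;> simp

theorem mem_levelBlocks_of_ne (φ : ZMod 3 → Q → Q) (i : ZMod 3) {a b : Q} (hab : a ≠ b) :
    ({.inl (φ i (a + b), i + 1), .inl (a, i), .inl (b, i)} : Finset ((Q × ZMod 3) ⊕ Fin 4)) ∈
      levelBlocks φ := by
  refine mem_image.mpr ⟨(i, {a, b}), by simp [hab], ?_⟩
  simp [levelBlock, sum_pair hab]

/-- A family containing all level blocks covers all pairs as soon as it covers the exceptional pairs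
between consecutive levels and the pairs involving the points of `I`. -/
theorem covers_of_levelBlocks_subset {φ : ZMod 3 → Q → Q} (hφ : ∀ i, (φ i).Surjective)
    {B : Finset (Finset ((Q × ZMod 3) ⊕ Fin 4))} {I : Finset (Fin 4)} (hB : levelBlocks φ ⊆ B)
    (h1 : ∀ c i, ∃ b ∈ B, .inl (c, i) ∈ b ∧ .inl (φ i (c + c), i + 1) ∈ b)
    (h2 : ∀ e ∈ I, ∀ a i, ∃ b ∈ B, .inl (a, i) ∈ b ∧ .inr e ∈ b)
    (h3 : ∀ e ∈ I, ∀ f ∈ I, e ≠ f → ∃ b ∈ B, .inr e ∈ b ∧ .inr f ∈ b) :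
    Covers B (univ.disjSum I) := by
  have hmix : ∀ a d i, ∃ b ∈ B, .inl (a, i) ∈ b ∧ .inl (d, i + 1) ∈ b := by
    intro a d i
    obtain ⟨c, rfl⟩ := hφ i d
    -- With `d = φ i c`, the pair lies in the level block over `a` and `c - a`, unless these
    -- coincide: those are the exceptional pairs.
    by_cases hc : a = c - a
    · obtain rfl : c = a + a := eq_add_of_sub_eq hc.symm
      exact h1 a i
    · refine ⟨_, hB (mem_levelBlocks_of_ne φ i hc), ?_, ?_⟩ <;> simp
  have hij : ∀ i j : ZMod 3, j = i ∨ j = i + 1 ∨ i = j + 1 := by decide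
  rintro (⟨a, i⟩ | e) hp (⟨b, j⟩ | f) hq hpq
  · rcases hij i j with rfl | rfl | rfl
    · refine ⟨_, hB (mem_levelBlocks_of_ne φ j (a := a) (b := b) ?_), ?_, ?_⟩
      · rintro rfl
        exact hpq rfl
      all_goals simp
    · exact hmix a b i
    · obtain ⟨s, hs, h, h'⟩ := hmix b a j
      exact ⟨s, hs, h', h⟩
  · exact h2 f (by simpa using hq) a i
  · obtain ⟨s, hs, h, h'⟩ := h2 e (by simpa using hp) b j
    exact ⟨s, hs, h', h⟩
  · exact h3 e (by simpa using hp) f (by simpa using hq) fun h => hpq (h ▸ rfl)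

end

/-! ### Steiner triple systems of orders 3 and 1 modulo 6 -/

/-- Halving in `ZMod m` for odd `m = 2 * k + 1`: multiplication by `k + 1`. -/
theorem ZMod.succ_mul_add_self {k : ℕ} (c : ZMod (2 * k + 1)) :
    ((k + 1 : ℕ) : ZMod (2 * k + 1)) * (c + c) = c := by
  have h : ((2 * k + 1 : ℕ) : ZMod (2 * k + 1)) = 0 := ZMod.natCast_self _
  push_cast at h ⊢
  linear_combination c * h

theorem ZMod.succ_mul_surjective (k : ℕ) :
    Function.Surjective fun c : ZMod (2 * k + 1) => ((k + 1 : ℕ) : ZMod (2 * k + 1)) * c :=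
  fun c => ⟨c + c, ZMod.succ_mul_add_self c⟩

theorem card_offDiag_disjSum (m : ℕ) [NeZero m] (I : Finset (Fin 4)) :
    #((univ : Finset (ZMod m × ZMod 3)).disjSum I).offDiag =
      (3 * m + #I) * (3 * m + #I) - (3 * m + #I) := by
  rw [offDiag_card, card_disjSum, card_univ, Fintype.card_prod, ZMod.card, ZMod.card, mul_comm m]

/-- The Bose construction of a Steiner triple system of order `6 * k + 3`. -/
theorem exists_isCore_bose (k : ℕ) : ∃ C,
    IsCore ((univ : Finset (ZMod (2 * k + 1) × ZMod 3)).disjSum (∅ : Finset (Fin 4))) ∅ C ∧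
      6 * #C ≤ (6 * k + 3) * (6 * k + 2) := by
  let φ : ZMod 3 → ZMod (2 * k + 1) → ZMod (2 * k + 1) := fun _ c => ((k + 1 : ℕ) : ZMod _) * c
  let D : Finset (Finset ((ZMod (2 * k + 1) × ZMod 3) ⊕ Fin 4)) :=
    univ.image fun c => {.inl (c, 0), .inl (c, 1), .inl (c, 2)}
  have hcard : 6 * #(levelBlocks φ ∪ D) ≤ (6 * k + 3) * (6 * k + 2) := by
    have h1 := card_levelBlocks_le φ
    have h2 : #D ≤ 2 * k + 1 := card_image_le.trans (by simp [ZMod.card])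
    have h3 := card_union_le (levelBlocks φ) D
    rw [ZMod.card] at h1
    have h5 : (2 * k + 1).choose 2 = (2 * k + 1) * k := by
      rw [Nat.choose_two_right]
      exact Nat.div_eq_of_eq_mul_left two_pos (by simp; ring)
    rw [h5] at h1
    nlinarith
  refine ⟨levelBlocks φ ∪ D, isCore_of_covers ?_ ?_ ?_ ?_, hcard⟩
  · intro s hs
    rcases mem_union.mp hs with hs | hs
    · exact card_of_mem_levelBlocks hs
    · obtain ⟨c, -, rfl⟩ := mem_image.mp hs
      exact card_eq_three.mpr ⟨_, _, _, by simp, by simp; decide, by simp; decide, rfl⟩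
  · intro s hs
    rcases mem_union.mp hs with hs | hs
    · exact levelBlocks_subset _ hs
    · obtain ⟨c, -, rfl⟩ := mem_image.mp hs
      intro x hx
      simp only [mem_insert, mem_singleton] at hx
      rcases hx with rfl | rfl | rfl <;> simp
  · refine covers_of_levelBlocks_subset (fun _ => ZMod.succ_mul_surjective k) subset_union_left
      ?_ (by simp) (by simp)
    intro c i
    refine ⟨_, mem_union_right _ (mem_image_of_mem _ (mem_univ c)), ?_⟩
    simp only [ZMod.succ_mul_add_self]
    exact ⟨inl_mem_fiber c i, inl_mem_fiber c (i + 1)⟩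
  · refine hcard.trans ?_
    rw [card_offDiag_disjSum, card_empty]
    apply Nat.le_sub_of_add_le
    ring_nf
    omega

/-- `c ↦ c / 2` for even and `c ↦ (c - 1) / 2 + k` for odd residues `c` modulo `2 * k`. -/
def skolemHalf (k : ℕ) (c : ZMod (2 * k)) : ZMod (2 * k) :=
  if Even c.val then (c.val / 2 : ℕ) else (c.val / 2 + k : ℕ)

theorem skolemHalf_surjective {k : ℕ} (hk : 0 < k) : (skolemHalf k).Surjective := by
  have : NeZero (2 * k) := ⟨by omega⟩
  intro d
  have hd := ZMod.val_lt d
  by_cases h : d.val < k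
  · refine ⟨((2 * d.val : ℕ) : ZMod (2 * k)), ?_⟩
    rw [skolemHalf, ZMod.val_natCast_of_lt (by omega), if_pos (even_two_mul _)]
    simp
  · refine ⟨((2 * (d.val - k) + 1 : ℕ) : ZMod (2 * k)), ?_⟩
    rw [skolemHalf, ZMod.val_natCast_of_lt (by omega), if_neg (by simp)]
    rw [show (2 * (d.val - k) + 1) / 2 + k = d.val by omega]
    simp

theorem skolemHalf_add_self {k i : ℕ} (hi : i < k) :
    skolemHalf k ((i : ZMod (2 * k)) + i) = i ∧
      skolemHalf k (((i + k : ℕ) : ZMod (2 * k)) + ((i + k : ℕ) : ZMod (2 * k))) = i := by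
  have h1 : (i : ZMod (2 * k)) + i = (2 * i : ℕ) := by push_cast; ring
  have h2 : ((i + k : ℕ) : ZMod (2 * k)) + ((i + k : ℕ) : ZMod (2 * k)) = (2 * i : ℕ) := by
    have h : ((2 * k : ℕ) : ZMod (2 * k)) = 0 := ZMod.natCast_self _
    push_cast at h ⊢
    linear_combination h
  rw [h1, h2, skolemHalf, ZMod.val_natCast_of_lt (by omega), if_pos (even_two_mul _)]
  simp

/-- The Skolem construction of a Steiner triple system of order `6 * k + 1`. -/
theorem exists_isCore_skolem {k : ℕ} [NeZero (2 * k)] : ∃ C,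
    IsCore ((univ : Finset (ZMod (2 * k) × ZMod 3)).disjSum ({0} : Finset (Fin 4))) ∅ C ∧
      6 * #C ≤ (6 * k + 1) * (6 * k) := by
  have hk : 0 < k := by
    have := NeZero.ne (2 * k)
    omega
  -- `skolemHalf` of `c + c` is `c` only for the residues below `k`, so only their fibres become
  -- blocks. The exceptional pairs from `i + k` lead to `i` one level up, and `E` completes them
  -- with the extra point.
  let D : Finset (Finset ((ZMod (2 * k) × ZMod 3) ⊕ Fin 4)) :=
    (range k).image fun c => {.inl (c, 0), .inl (c, 1), .inl (c, 2)}
  let E : Finset (Finset ((ZMod (2 * k) × ZMod 3) ⊕ Fin 4)) :=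
    (range k ×ˢ univ).image fun p =>
      {.inr 0, .inl (((p.1 + k : ℕ) : ZMod (2 * k)), p.2), .inl (p.1, p.2 + 1)}
  have hcases : ∀ c : ZMod (2 * k), ∃ i < k, c = i ∨ c = (i + k : ℕ) := by
    intro c
    have hc := ZMod.val_lt c
    by_cases h : c.val < k
    · exact ⟨c.val, h, .inl (by simp)⟩
    · exact ⟨c.val - k, by omega, .inr (by rw [Nat.sub_add_cancel (by omega)]; simp)⟩
  set B := levelBlocks (fun _ => skolemHalf k) ∪ (D ∪ E) with hB
  have hD : D ⊆ B := subset_union_left.trans subset_union_right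
  have hE : E ⊆ B := subset_union_right.trans subset_union_right
  have hcard : 6 * #B ≤ (6 * k + 1) * (6 * k) := by
    have h1 := card_levelBlocks_le fun _ : ZMod 3 => skolemHalf k
    have h2 : #D ≤ k := card_image_le.trans (by simp)
    have h3 : #E ≤ k * 3 := card_image_le.trans (by simp [ZMod.card])
    have h4 := card_union_le (levelBlocks fun _ : ZMod 3 => skolemHalf k) (D ∪ E)
    have h5 := card_union_le D E
    rw [ZMod.card] at h1
    obtain ⟨j, rfl⟩ := Nat.exists_eq_add_of_le' hk
    have h6 : (2 * (j + 1)).choose 2 = (j + 1) * (2 * j + 1) := by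
      rw [Nat.choose_two_right]
      exact Nat.div_eq_of_eq_mul_left two_pos
        (by rw [show 2 * (j + 1) - 1 = 2 * j + 1 by omega]; ring)
    rw [h6] at h1
    nlinarith
  refine ⟨B, isCore_of_covers ?_ ?_ ?_ ?_, hcard⟩
  · intro s hs
    simp only [hB, mem_union] at hs
    rcases hs with hs | hs | hs
    · exact card_of_mem_levelBlocks hs
    · obtain ⟨c, -, rfl⟩ := mem_image.mp hs
      exact card_eq_three.mpr ⟨_, _, _, by simp, by simp; decide, by simp; decide, rfl⟩
    · obtain ⟨p, -, rfl⟩ := mem_image.mp hs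
      exact card_eq_three.mpr ⟨_, _, _, by simp, by simp, by simp, rfl⟩
  · intro s hs
    simp only [hB, mem_union] at hs
    rcases hs with hs | hs | hs
    · exact levelBlocks_subset _ hs
    · obtain ⟨c, -, rfl⟩ := mem_image.mp hs
      intro x hx
      simp only [mem_insert, mem_singleton] at hx
      rcases hx with rfl | rfl | rfl <;> simp
    · obtain ⟨p, -, rfl⟩ := mem_image.mp hs
      intro x hx
      simp only [mem_insert, mem_singleton] at hx
      rcases hx with rfl | rfl | rfl <;> simp
  · refine covers_of_levelBlocks_subset (fun _ => skolemHalf_surjective hk) subset_union_left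
      ?_ ?_ ?_
    · intro c i
      obtain ⟨j, hj, rfl | rfl⟩ := hcases c
      · refine ⟨_, hD (mem_image_of_mem _ (mem_range.mpr hj)), ?_⟩
        rw [(skolemHalf_add_self hj).1]
        exact ⟨inl_mem_fiber _ i, inl_mem_fiber _ (i + 1)⟩
      · refine ⟨_, hE (mem_image_of_mem _ (mk_mem_product (mem_range.mpr hj) (mem_univ i))), ?_⟩
        rw [(skolemHalf_add_self hj).2]
        simp
    · intro e he a i
      obtain rfl := mem_singleton.mp he
      obtain ⟨j, hj, rfl | rfl⟩ := hcases a
      · refine ⟨_, hE (mem_image_of_mem _ (mk_mem_product (mem_range.mpr hj)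
          (mem_univ (i - 1)))), ?_⟩
        simp
      · refine ⟨_, hE (mem_image_of_mem _ (mk_mem_product (mem_range.mpr hj) (mem_univ i))), ?_⟩
        simp
    · intro e he f hf hef
      exact absurd ((mem_singleton.mp he).trans (mem_singleton.mp hf).symm) hef
  · refine hcard.trans ?_
    rw [card_offDiag_disjSum, card_singleton]
    apply Nat.le_sub_of_add_le
    ring_nf
    omega

/-! ### Order 5 modulo 6: a linear space with one block of size 5 -/

/-- The exceptional block of size `5` in the system of order `6 * k + 5`. -/
def exceptionalBlock (Q : Type*) [Zero Q] : Finset ((Q × ZMod 3) ⊕ Fin 4) :=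
  (({0} : Finset Q) ×ˢ univ).disjSum {0, 1}

theorem card_exceptionalBlock (Q : Type*) [Zero Q] : #(exceptionalBlock Q) = 5 := by
  simp [exceptionalBlock, card_disjSum, ZMod.card]

/-- The six triples joining the exceptional points to the hexagon over `c` and `-c`. -/
def hexagonBlocks {Q : Type*} [DecidableEq Q] [Neg Q] (c : Q) :
    Finset (Finset ((Q × ZMod 3) ⊕ Fin 4)) :=
  {{.inr 0, .inl (c, 0), .inl (c, 1)}, {.inr 0, .inl (c, 2), .inl (-c, 0)},
    {.inr 0, .inl (-c, 1), .inl (-c, 2)}, {.inr 1, .inl (c, 1), .inl (c, 2)},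
    {.inr 1, .inl (-c, 0), .inl (-c, 1)}, {.inr 1, .inl (-c, 2), .inl (c, 0)}}

/-- Because of the sign change from level 2 to level 0, the exceptional pairs close up only after
six steps. An even cycle has a proper 2-colouring of its edges; the colours are the two extra
points, each of which thus meets every vertex. -/
theorem exists_hexagonBlock_of_edge {Q : Type*} [DecidableEq Q] [InvolutiveNeg Q] (c : Q)
    {d : Q} (hd : d = c ∨ d = -c) (i : ZMod 3) :
    ∃ b ∈ hexagonBlocks c, .inl (d, i) ∈ b ∧ .inl (if i = 2 then -d else d, i + 1) ∈ b := by
  have hi : ∀ i : ZMod 3, i = 0 ∨ i = 1 ∨ i = 2 := by decide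
  have h11 : (1 : ZMod 3) + 1 = 2 := by decide
  have h21 : (2 : ZMod 3) + 1 = 0 := by decide
  have h02 : (0 : ZMod 3) ≠ 2 := by decide
  have h12 : (1 : ZMod 3) ≠ 2 := by decide
  rcases hd with rfl | rfl <;> rcases hi i with rfl | rfl | rfl <;>
    simp [hexagonBlocks, h11, h21, h02, h12]

theorem exists_hexagonBlock_of_point {Q : Type*} [DecidableEq Q] [InvolutiveNeg Q] (c : Q)
    {d : Q} (hd : d = c ∨ d = -c) (i : ZMod 3) {e : Fin 4} (he : e = 0 ∨ e = 1) :
    ∃ b ∈ hexagonBlocks c, .inl (d, i) ∈ b ∧ .inr e ∈ b := by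
  have hi : ∀ i : ZMod 3, i = 0 ∨ i = 1 ∨ i = 2 := by decide
  rcases hd with rfl | rfl <;> rcases hi i with rfl | rfl | rfl <;> rcases he with rfl | rfl <;>
    simp [hexagonBlocks]

/-- The twisted Bose construction: a linear space of order `6 * k + 5` with one block of size `5`
and all other blocks of size `3`. -/
theorem exists_space_five_mod_six (k : ℕ) :
    ∃ B : Finset (Finset ((ZMod (2 * k + 1) × ZMod 3) ⊕ Fin 4)),
      (∀ s ∈ B, #s = 3) ∧ (∀ s ∈ B, s ⊆ univ.disjSum {0, 1}) ∧
      Covers (insert (exceptionalBlock _) B) (univ.disjSum {0, 1}) ∧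
      IsLinear (insert (exceptionalBlock _) B) ∧ 6 * #B + 20 ≤ (6 * k + 5) * (6 * k + 4) := by
  -- The twist at level 2 turns the exceptional pairs into hexagons over `{c, -c}` for `c ≠ 0`; over
  -- `0` they remain a triangle, absorbed with the two extra points by the block of size 5.
  let φ : ZMod 3 → ZMod (2 * k + 1) → ZMod (2 * k + 1) := fun i c =>
    if i = 2 then -(((k + 1 : ℕ) : ZMod _) * c) else ((k + 1 : ℕ) : ZMod _) * c
  have hφ : ∀ i, (φ i).Surjective := by
    intro i d
    by_cases hi : i = 2
    · obtain ⟨c, hc⟩ := ZMod.succ_mul_surjective k (-d)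
      exact ⟨c, by simp only [φ, if_pos hi]; exact neg_eq_iff_eq_neg.mpr hc⟩
    · obtain ⟨c, hc⟩ := ZMod.succ_mul_surjective k d
      exact ⟨c, by simp only [φ, if_neg hi]; exact hc⟩
  let E : Finset (Finset ((ZMod (2 * k + 1) × ZMod 3) ⊕ Fin 4)) :=
    (range k).biUnion fun j => hexagonBlocks ((j + 1 : ℕ) : ZMod (2 * k + 1))
  have hcases : ∀ c : ZMod (2 * k + 1), c = 0 ∨ ∃ j < k, c = (j + 1 : ℕ) ∨ c = -(j + 1 : ℕ) := by
    intro c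
    have hc := ZMod.val_lt c
    by_cases h0 : c.val = 0
    · exact .inl ((ZMod.val_eq_zero c).mp h0)
    by_cases h : c.val ≤ k
    · exact .inr ⟨c.val - 1, by omega, .inl (by rw [Nat.sub_add_cancel (by omega)]; simp)⟩
    · refine .inr ⟨2 * k - c.val, by omega, .inr ?_⟩
      rw [← add_eq_zero_iff_eq_neg]
      nth_rw 1 [← ZMod.natCast_zmod_val c]
      rw [← Nat.cast_add, show c.val + (2 * k - c.val + 1) = 2 * k + 1 by omega]
      exact ZMod.natCast_self _
  have hne : ∀ j < k, ((j + 1 : ℕ) : ZMod (2 * k + 1)) ≠ -((j + 1 : ℕ) : ZMod (2 * k + 1)) := by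
    intro j hj h
    rw [← add_eq_zero_iff_eq_neg, ← Nat.cast_add, ZMod.natCast_eq_zero_iff] at h
    have := Nat.le_of_dvd (by omega) h
    omega
  have hEcard : ∀ s ∈ E, #s = 3 := by
    intro s hs
    obtain ⟨j, hj, hs⟩ := mem_biUnion.mp hs
    have h := hne j (mem_range.mp hj)
    have h01 : (0 : ZMod 3) ≠ 1 := by decide
    have h12 : (1 : ZMod 3) ≠ 2 := by decide
    have h20 : (2 : ZMod 3) ≠ 0 := by decide
    simp only [hexagonBlocks, mem_insert, mem_singleton] at hs
    rcases hs with rfl | rfl | rfl | rfl | rfl | rfl <;>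
      refine card_eq_three.mpr ⟨_, _, _, Sum.inr_ne_inl, Sum.inr_ne_inl, ?_, rfl⟩ <;>
      intro e <;> simp only [Sum.inl.injEq, Prod.mk.injEq] at e <;> tauto
  have hsub : ∀ s ∈ insert (exceptionalBlock _) (levelBlocks φ ∪ E),
      s ⊆ univ.disjSum ({0, 1} : Finset (Fin 4)) := by
    intro s hs
    simp only [mem_insert, mem_union] at hs
    rcases hs with rfl | hs | hs
    · exact disjSum_mono (subset_univ _) Subset.rfl
    · exact levelBlocks_subset _ hs
    · obtain ⟨j, hj, hs⟩ := mem_biUnion.mp hs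
      simp only [hexagonBlocks, mem_insert, mem_singleton] at hs
      rcases hs with rfl | rfl | rfl | rfl | rfl | rfl <;> simp [insert_subset_iff]
  have hEmem : ∀ j < k, ∀ s ∈ hexagonBlocks ((j + 1 : ℕ) : ZMod (2 * k + 1)),
      s ∈ insert (exceptionalBlock _) (levelBlocks φ ∪ E) := fun j hj s hs =>
    mem_insert_of_mem (mem_union_right _ (mem_biUnion.mpr ⟨j, mem_range.mpr hj, hs⟩))
  have hcov : Covers (insert (exceptionalBlock _) (levelBlocks φ ∪ E))
      (univ.disjSum ({0, 1} : Finset (Fin 4))) := by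
    refine covers_of_levelBlocks_subset hφ (subset_union_left.trans (subset_insert _ _)) ?_ ?_ ?_
    · intro c i
      have hval : φ i (c + c) = if i = 2 then -c else c := by
        simp only [φ, ZMod.succ_mul_add_self]
      rw [hval]
      obtain rfl | ⟨j, hj, hc⟩ := hcases c
      · exact ⟨_, mem_insert_self _ _, by simp [exceptionalBlock], by simp [exceptionalBlock]⟩
      · obtain ⟨b, hb, h⟩ := exists_hexagonBlock_of_edge _ hc i
        exact ⟨b, hEmem j hj b hb, h⟩
    · intro e he c i
      obtain rfl | ⟨j, hj, hc⟩ := hcases c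
      · exact ⟨_, mem_insert_self _ _, by simp [exceptionalBlock],
          by simpa [exceptionalBlock] using he⟩
      · obtain ⟨b, hb, h⟩ := exists_hexagonBlock_of_point _ hc i (by simpa using he)
        exact ⟨b, hEmem j hj b hb, h⟩
    · exact fun e he f hf _ => ⟨_, mem_insert_self _ _, by simpa [exceptionalBlock] using he,
        by simpa [exceptionalBlock] using hf⟩
  have hcard : 6 * #(levelBlocks φ ∪ E) + 20 ≤ (6 * k + 5) * (6 * k + 4) := by
    have h1 := card_levelBlocks_le φ
    have h2 : #E ≤ k * 6 := by
      refine (card_biUnion_le_card_mul _ _ 6 fun j _ => card_le_six).trans (by simp)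
    have h3 := card_union_le (levelBlocks φ) E
    rw [ZMod.card] at h1
    have h5 : (2 * k + 1).choose 2 = (2 * k + 1) * k := by
      rw [Nat.choose_two_right]
      exact Nat.div_eq_of_eq_mul_left two_pos (by simp; ring)
    rw [h5] at h1
    nlinarith
  have hcard3 : ∀ s ∈ levelBlocks φ ∪ E, #s = 3 := fun s hs =>
    (mem_union.mp hs).elim card_of_mem_levelBlocks (hEcard s)
  refine ⟨_, hcard3, fun s hs => hsub s (mem_insert_of_mem hs), hcov,
    isLinear_of_covers hsub hcov ?_, hcard⟩
  rw [sum_insert fun h => by simpa [card_exceptionalBlock] using hcard3 _ h,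
    sum_congr rfl fun s hs => by rw [offDiag_card, hcard3 s hs], sum_const, smul_eq_mul,
    offDiag_card, card_exceptionalBlock, card_offDiag_disjSum, card_pair (by decide)]
  apply Nat.le_sub_of_add_le
  ring_nf at hcard ⊢
  omega

/-! ### Cores of orders 5 and 4 modulo 6 -/

/-- Only the pairs inside `b ∩ Z` lose their block when `b` is dropped, and a small core on that set
repairs them. `Y` may contain one point of `P`, which permits deleting a point of `b` from `Z`. -/
theorem IsCore.replace {α : Type*} [DecidableEq α] {Z Y P b : Finset α} {B D : Finset (Finset α)}
    (hZY : Disjoint Z Y) (hP : P ⊆ Z ∪ Y) (hPY : #(P ∩ Y) ≤ 1) (hYb : Y ∩ P ⊆ b)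
    (hB : ∀ s ∈ B, #s = 3) (hBP : ∀ s ∈ B, s ⊆ P) (hb : b ∉ B) (hlin : IsLinear (insert b B))
    (hcov : Covers (insert b B) Z) (hD : IsCore (b ∩ Z) Y D) : IsCore Z Y (B ∪ D) where
  disj := hZY
  card_eq s hs := (mem_union.mp hs).elim (hB s) (hD.card_eq s)
  subset s hs := (mem_union.mp hs).elim (fun h => (hBP s h).trans hP) fun h =>
    (hD.subset s h).trans (union_subset_union_left inter_subset_right)
  card_inter s hs := (mem_union.mp hs).elim
    (fun h => (card_le_card (inter_subset_inter_right (hBP s h))).trans hPY) (hD.card_inter s)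
  linear := IsLinear.replace hBP hlin hb hD.linear fun d hd x hx => by
    obtain ⟨hxd, hxP⟩ := mem_inter.mp hx
    rcases mem_union.mp (hD.subset d hd hxd) with h | h
    · exact (mem_inter.mp h).1
    · exact hYb (mem_inter.mpr ⟨h, hxP⟩)
  covers p hp q hq hpq := by
    obtain ⟨s, hs, h1, h2⟩ := hcov p hp q hq hpq
    rcases mem_insert.mp hs with rfl | hs
    · obtain ⟨d, hd, h⟩ := hD.covers p (mem_inter.mpr ⟨h1, hp⟩) q (mem_inter.mpr ⟨h2, hq⟩) hpq
      exact ⟨d, mem_union_right _ hd, h⟩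
    · exact ⟨s, mem_union_left _ hs, h1, h2⟩

/-- The inclusion of the points over `0` together with the extra points. -/
def fiberEmbedding (Q : Type*) [Zero Q] : ZMod 3 ⊕ Fin 4 ↪ (Q × ZMod 3) ⊕ Fin 4 :=
  ⟨Sum.map (Prod.mk 0) id, Sum.map_injective.mpr ⟨Prod.mk_right_injective 0, Function.injective_id⟩⟩

set_option maxRecDepth 8000 in
theorem exists_isCore_five_mod_six (k : ℕ) : ∃ C,
    IsCore ((univ : Finset (ZMod (2 * k + 1) × ZMod 3)).disjSum ({0, 1} : Finset (Fin 4)))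
      (disjSum ∅ {2, 3}) C ∧ 6 * #C ≤ (6 * k + 5) * (6 * k + 4) + 16 := by
  obtain ⟨B, h3, hsub, hcov, hlin, hcard⟩ := exists_space_five_mod_six k
  -- Two triples meeting in no point but `inr 0` leave a 4-cycle of uncovered pairs on the five
  -- points; its two perfect matchings are completed by `inr 2` and `inr 3`.
  let D : Finset (Finset (ZMod 3 ⊕ Fin 4)) :=
    {{.inr 0, .inr 1, .inl 0}, {.inr 0, .inl 1, .inl 2}, {.inr 1, .inl 1, .inr 2},
      {.inl 0, .inl 2, .inr 2}, {.inr 1, .inl 2, .inr 3}, {.inl 0, .inl 1, .inr 3}}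
  have hD : IsCore (univ.disjSum {0, 1}) (disjSum ∅ {2, 3}) D :=
    ⟨by decide, by decide, by decide, by decide, by unfold IsLinear; decide,
      by unfold Covers; decide⟩
  have hD' := hD.map (fiberEmbedding (ZMod (2 * k + 1)))
  refine ⟨_, .replace (b := exceptionalBlock _) ?_ ?_ ?_ ?_ h3 hsub ?_ hlin hcov
    (D := D.image (map (fiberEmbedding _))) ?_, ?_⟩
  · rw [disjoint_left]; rintro (x | e) <;> simp; decide +revert
  · rintro (x | e) <;> simp; decide +revert
  · refine (card_le_card (t := {.inr 1}) ?_).trans (card_singleton _).le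
    rintro (x | e) <;> simp
  · rintro (x | e) <;> simp [exceptionalBlock]
  · intro h
    simpa [card_exceptionalBlock] using h3 _ h
  · convert hD' using 1
    · ext (⟨a, i⟩ | e)
      · simp [fiberEmbedding, exceptionalBlock]
      · simp [fiberEmbedding, exceptionalBlock]
    · ext (x | e) <;> simp [fiberEmbedding]
  · have h1 := card_union_le B (D.image (map (fiberEmbedding _)))
    have h2 : #(D.image (map (fiberEmbedding (ZMod (2 * k + 1))))) ≤ 6 :=
      card_image_le.trans card_le_six
    omega

set_option maxRecDepth 8000 in
theorem exists_isCore_four_mod_six (k : ℕ) : ∃ C,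
    IsCore ((univ : Finset (ZMod (2 * k + 1) × ZMod 3)).disjSum ({0} : Finset (Fin 4)))
      (disjSum ∅ {1, 2, 3}) C ∧ 6 * #C ≤ (6 * k + 5) * (6 * k + 4) + 4 := by
  obtain ⟨B, h3, hsub, hcov, hlin, hcard⟩ := exists_space_five_mod_six k
  -- With `inr 1` moved to `Y`, four points of the block remain: one triple, and a star at `inr 0`
  -- whose three pairs are completed by the three points of `Y`.
  let D : Finset (Finset (ZMod 3 ⊕ Fin 4)) :=
    {{.inl 0, .inl 1, .inl 2}, {.inr 0, .inl 0, .inr 1}, {.inr 0, .inl 1, .inr 2},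
      {.inr 0, .inl 2, .inr 3}}
  have hD : IsCore (univ.disjSum {0}) (disjSum ∅ {1, 2, 3}) D :=
    ⟨by decide, by decide, by decide, by decide, by unfold IsLinear; decide,
      by unfold Covers; decide⟩
  have hD' := hD.map (fiberEmbedding (ZMod (2 * k + 1)))
  refine ⟨_, .replace (b := exceptionalBlock _) ?_ ?_ ?_ ?_ h3 hsub ?_ hlin (hcov.mono ?_)
    (D := D.image (map (fiberEmbedding _))) ?_, ?_⟩
  · rw [disjoint_left]; rintro (x | e) <;> simp; decide +revert
  · rintro (x | e) <;> simp; decide +revert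
  · refine (card_le_card (t := {.inr 1}) ?_).trans (card_singleton _).le
    rintro (x | e) <;> simp
  · rintro (x | e) <;> simp [exceptionalBlock]; decide +revert
  · intro h
    simpa [card_exceptionalBlock] using h3 _ h
  · rintro (x | e) <;> simp; decide +revert
  · convert hD' using 1
    · ext (⟨a, i⟩ | e)
      · simp [fiberEmbedding, exceptionalBlock]
      · simp [fiberEmbedding, exceptionalBlock]; grind
    · ext (x | e) <;> simp [fiberEmbedding]
  · have h1 := card_union_le B (D.image (map (fiberEmbedding _)))
    have h2 : #(D.image (map (fiberEmbedding (ZMod (2 * k + 1))))) ≤ 4 :=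
      card_image_le.trans card_le_four
    omega

/-! ### Cores of every size and the choice of parameters -/

theorem exists_core (z : ℕ) (hz : 2 ≤ z) (α : Type*) [Infinite α] [DecidableEq α] :
    ∃ (Z Y : Finset α) (C : Finset (Finset α)), IsCore Z Y C ∧ #Z = z ∧ #Y ≤ 4 ∧
      6 * #C ≤ z * z + z + 9 := by
  have transfer : ∀ {m : ℕ} [NeZero m] {Z Y : Finset ((ZMod m × ZMod 3) ⊕ Fin 4)} {C},
      IsCore Z Y C → #Z = z → #Y ≤ 4 → 6 * #C ≤ z * z + z + 9 →
      ∃ (Z Y : Finset α) (C : Finset (Finset α)), IsCore Z Y C ∧ #Z = z ∧ #Y ≤ 4 ∧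
        6 * #C ≤ z * z + z + 9 := by
    intro m _ Z Y C h hZ hY hC
    let f : ((ZMod m × ZMod 3) ⊕ Fin 4) ↪ α :=
      (Fintype.equivFin _).toEmbedding.trans (Fin.valEmbedding.trans (Infinite.natEmbedding α))
    refine ⟨_, _, _, h.map f, by rwa [card_map], by rwa [card_map], ?_⟩
    exact (Nat.mul_le_mul_left 6 card_image_le).trans hC
  obtain ⟨k, rfl | rfl | rfl | rfl | rfl | rfl⟩ : ∃ k, z = 6 * k ∨ z = 6 * k + 1 ∨ z = 6 * k + 2 ∨
      z = 6 * k + 3 ∨ z = 6 * k + 4 ∨ z = 6 * k + 5 := ⟨z / 6, by omega⟩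
  · have : NeZero (2 * k) := ⟨by omega⟩
    obtain ⟨C, h, hC⟩ := exists_isCore_skolem (k := k)
    refine transfer (h.erase (.inr 0)) ?_ (by simp) (by nlinarith)
    rw [card_erase_of_mem (by simp)]
    simp [card_disjSum, ZMod.card]
    omega
  · have : NeZero (2 * k) := ⟨by omega⟩
    obtain ⟨C, h, hC⟩ := exists_isCore_skolem (k := k)
    refine transfer h ?_ (by simp) (by nlinarith)
    simp [card_disjSum, ZMod.card]
    omega
  · obtain ⟨C, h, hC⟩ := exists_isCore_bose k
    refine transfer (h.erase (.inl (0, 0))) ?_ (by simp) (by nlinarith)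
    rw [card_erase_of_mem (by simp)]
    simp [ZMod.card]
    omega
  · obtain ⟨C, h, hC⟩ := exists_isCore_bose k
    refine transfer h ?_ (by simp) (by nlinarith)
    simp [ZMod.card]
    omega
  · obtain ⟨C, h, hC⟩ := exists_isCore_four_mod_six k
    refine transfer h ?_ (by simp) (by nlinarith)
    simp [ZMod.card]
    omega
  · obtain ⟨C, h, hC⟩ := exists_isCore_five_mod_six k
    refine transfer h ?_ (by simp) (by nlinarith)
    simp [ZMod.card]
    omega

theorem exists_partialSTS_no_embedding (u t : ℕ) (hu : 2 ≤ u)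
    (ht : ((u : ℝ) + 1) / 2 ≤ (t : ℝ)) (ht' : (t : ℝ) < ((u : ℝ) ^ 2 - 5 * (u : ℝ) + 16) / 6)
    (α : Type*) [Infinite α] : ∃ S : PartialSTS α,
      S.order = u ∧ S.triples.card ≤ t ∧
      ∀ v : ℕ, (v : ℝ) ≤ (u : ℝ) + Real.sqrt (6 * (t : ℝ) - 3 * (u : ℝ)) - 1 →
        ¬ S.HasEmbedding v := by
  classical
  have h1 : u + 1 ≤ 2 * t := by
    have : (u : ℝ) + 1 ≤ 2 * t := by linarith
    exact_mod_cast this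
  have h2 : 6 * t + 5 * u < u * u + 16 := by
    have : 6 * (t : ℝ) + 5 * u < u * u + 16 := by nlinarith
    exact_mod_cast this
  obtain ⟨k, hk⟩ : ∃ k, 6 * t = 3 * u + k := ⟨6 * t - 3 * u, by omega⟩
  have hr1 := Nat.sqrt_le k
  have hr2 := Nat.lt_succ_sqrt k
  set r := Nat.sqrt k
  -- The upper bound on `t` says exactly that `k < (u - 4)²`.
  have hr : r + 5 ≤ u := by
    by_contra hcon
    obtain hlt | hle := lt_or_ge u 5
    · interval_cases u <;> omega
    · obtain ⟨q, rfl⟩ := Nat.exists_eq_add_of_le' hle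
      have : q + 1 ≤ r := by omega
      nlinarith
  -- Parity of `u - r` decides between `r` and `r + 1`, and `r + 5 ≤ u` leaves `a ≥ 2`, room for
  -- four points of `Y`. The value `z = 1` cannot occur: `r = 1` forces `k = 3` and `u` odd, and
  -- then `z = r + 1`.
  obtain ⟨z, hz2, hzr, hzr', a, ha, hua⟩ : ∃ z, 2 ≤ z ∧ z ≤ r + 1 ∧ r ≤ z ∧
      ∃ a, 2 ≤ a ∧ u = z + 2 * a + 1 := by
    have hr0 : r ≠ 0 := by
      intro h0
      rw [h0] at hr2
      omega
    rcases Nat.even_or_odd (u - r) with ⟨b, hb⟩ | ⟨b, hb⟩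
    · exact ⟨r + 1, by omega, le_rfl, by omega, b - 1, by omega, by omega⟩
    · refine ⟨r, ?_, by omega, le_rfl, b, by omega, by omega⟩
      by_contra hcon
      have h1r : r = 1 := by omega
      rw [h1r] at hr2
      omega
  obtain ⟨Z, Y, C, hC, hZ, hY, hcard⟩ := exists_core z hz2 α
  obtain ⟨S, hS, hSt, hSv⟩ := PartialSTS.exists_of_isCore hC (a := a) (by omega)
  refine ⟨S, by omega, ?_, fun v hv hemb => ?_⟩
  -- Six times the number of triples is at most `(z - 1)² + 3u + 5 ≤ r² + 3u + 5 ≤ 6t + 5`; the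
  -- excess 5 disappears by integrality.
  · obtain ⟨y, rfl⟩ := Nat.exists_eq_add_of_le' hz2
    have : (y + 1) * (y + 1) ≤ r * r := Nat.mul_le_mul (by omega) (by omega)
    nlinarith
  · have h3 := hSv v hemb
    have h4 : ((z : ℝ) + 1) ≤ Real.sqrt (6 * (t : ℝ) - 3 * (u : ℝ)) := by
      have : ((u + z : ℕ) : ℝ) ≤ v := by exact_mod_cast (by omega : u + z ≤ v)
      push_cast at this
      linarith
    have h5 : ((z : ℝ) + 1) ^ 2 ≤ 6 * (t : ℝ) - 3 * (u : ℝ) :=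
      (Real.le_sqrt' (by positivity)).mp h4
    have h6 : (z + 1) * (z + 1) ≤ k := by
      have hk' : 6 * (t : ℝ) = 3 * u + k := by exact_mod_cast hk
      have : ((z : ℝ) + 1) * (z + 1) ≤ k := by nlinarith
      exact_mod_cast this
    have : (r + 1) * (r + 1) ≤ (z + 1) * (z + 1) := Nat.mul_le_mul (by omega) (by omega)
    simp only [Nat.succ_eq_add_one] at hr2
    omega

theorem exists_partialSTS_no_small_embedding (u : ℕ) (hu : 100000 ≤ u) (α : Type*) [Infinite α] :
    ∃ S : PartialSTS α, S.order = u ∧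
      (S.triples.card : ℝ) ≤ (u : ℝ) ^ 2 / 50 - 11 * (u : ℝ) / 100 - 116 / 75 ∧
      ∀ v : ℕ, (v : ℝ) < (1.346 : ℝ) * (u : ℝ) → ¬ S.HasEmbedding v := by
  have hu' : (100000 : ℝ) ≤ u := by exact_mod_cast hu
  set b : ℝ := (u : ℝ) ^ 2 / 50 - 11 * (u : ℝ) / 100 - 116 / 75 with hb
  have hb0 : 0 ≤ b := by nlinarith
  have hle := Nat.floor_le hb0
  have hlt := Nat.lt_floor_add_one b
  obtain ⟨S, h1, h2, h3⟩ := exists_partialSTS_no_embedding u ⌊b⌋₊ (by omega) (by nlinarith)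
    (by nlinarith) α
  refine ⟨S, h1, le_trans (by exact_mod_cast h2) hle, fun v hv => h3 v ?_⟩
  -- The leading coefficients are `0.346² = 0.119716 < 6/50`; the large lower bound on `u` lets this
  -- small gap absorb the linear terms and the rounding of `b`.
  have : (0.346 : ℝ) * u + 1 ≤ Real.sqrt (6 * (⌊b⌋₊ : ℝ) - 3 * (u : ℝ)) := by
    apply Real.le_sqrt_of_sq_le
    nlinarith
  linarith

theorem corollary5p2 :
    (∀ u t : ℕ, 2 ≤ u → ((u : ℝ) + 1) / 2 ≤ (t : ℝ) →
      (t : ℝ) < ((u : ℝ) ^ 2 - 5 * (u : ℝ) + 16) / 6 →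
      ∀ (α : Type*) [Infinite α], ∃ S : PartialSTS α,
        S.order = u ∧ S.triples.card ≤ t ∧
        ∀ v : ℕ, (v : ℝ) ≤ (u : ℝ) + Real.sqrt (6 * (t : ℝ) - 3 * (u : ℝ)) - 1 →
          ¬ S.HasEmbedding v) ∧
    (∃ N : ℕ, ∀ u : ℕ, N ≤ u →
      ∀ (α : Type*) [Infinite α], ∃ S : PartialSTS α,
        S.order = u ∧
        (S.triples.card : ℝ) ≤ (u : ℝ) ^ 2 / 50 - 11 * (u : ℝ) / 100 - 116 / 75 ∧
        ∀ v : ℕ, (v : ℝ) < (1.346 : ℝ) * (u : ℝ) → ¬ S.HasEmbedding v) :=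
  ⟨fun u t hu ht ht' α _ => exists_partialSTS_no_embedding u t hu ht ht' α,
    100000, fun u hu α _ => exists_partialSTS_no_small_embedding u hu α⟩
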